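/- Let $m$ be a fixed positive integer and let $\Phi(t)=\frac{1}{\sqrt{2\pi}}\int_{-\infty}^{t}e^{-x^2/2}\,dx$. Call $\beta\in(0,1)$ admissible if for some $\mu>0$ and some $0<\delta<1$, $$\beta\log\tfrac1\beta+(1-\beta)\log\tfrac1{1-\beta}+m\beta\Big[\log 2+\tfrac{m\mu^2}{2}+\log\Phi(\mu\sqrt m)\Big]+\Big(\tfrac{1}{2m-1}-\beta\Big)\Big[\log 2+\tfrac12\mu^2(1-\delta)^2+\log\big(1-\Phi(\mu(1-\delta))\big)\Big]<0 .$$ Then admissible $\beta$ exist. Moreover, for every admissible $\beta$ there are a constant $c_1>0$ and an integer $N$, depending only on $m$ and $\beta$, such that for every $n\ge N$ the following holds. Let $h_i$, $-m+2\le i\le n$, be i.i.d. $N(0,1)$ random variables, and let $H$ be the $n\times m$ matrix whose entry in row $i$ and column $j$ is $h_{-m+i+j}$ ($1\le i\le n$, $1\le j\le m$), so that its first row is $h_{-m+2},\dots,h_1$ and its last row is $h_{-m+n+1},\dots,h_n$. Then with probability at least $1-e^{-c_1n}$ the matrix $H$ has the following property: for every $x\in\mathbb R^m$ and every $e\in\mathbb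 R^n$ with at most $\beta n$ nonzero entries, $x$ is the unique solution of $\min_{u\in\mathbb R^m}\|y-Hu\|_1$, where $y=Hx+e$. -/

import Mathlib

open MeasureTheory ProbabilityTheory

namespace ToeplitzL1

/-- The cumulative distribution function of the standard Gaussian law,
`Φ(t) = (2π)^(-1/2) ∫_{-∞}^t exp(-x²/2) dx`. -/
noncomputable def Phi (t : ℝ) : ℝ :=
  1 / Real.sqrt (2 * Real.pi) * ∫ x in Set.Iic t, Real.exp (-x ^ 2 / 2)

/-- The left-hand side of the entropy / Gaussian-tail inequality. -/
noncomputable def rateExponent (m : ℕ) (β μ δ : ℝ) : ℝ :=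
  β * Real.log (1 / β) + (1 - β) * Real.log (1 / (1 - β))
    + m * β * (Real.log 2 + m * μ ^ 2 / 2 + Real.log (Phi (μ * Real.sqrt m)))
    + (1 / (2 * (m : ℝ) - 1) - β) *
        (Real.log 2 + 1 / 2 * μ ^ 2 * (1 - δ) ^ 2 + Real.log (1 - Phi (μ * (1 - δ))))

/-- `β` lies in `(0, 1)` and the inequality holds for some `μ > 0` and some `0 < δ < 1`. -/
def IsAdmissible (m : ℕ) (β : ℝ) : Prop :=
  0 < β ∧ β < 1 ∧ ∃ μ δ : ℝ, 0 < μ ∧ 0 < δ ∧ δ < 1 ∧ rateExponent m β μ δ < 0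

/-- The `n × m` matrix with first row `h_{-m+2}, …, h_1` and last row `h_{-m+n+1}, …, h_n`;
rows and columns are numbered from zero. -/
def toeplitz (n m : ℕ) (h : ℤ → ℝ) : Matrix (Fin n) (Fin m) ℝ :=
  Matrix.of fun i j => h (-(m : ℤ) + 2 + ((i : ℕ) : ℤ) + ((j : ℕ) : ℤ))

/-- The `ℓ₁` norm of a vector. -/
def l1Norm {n : ℕ} (v : Fin n → ℝ) : ℝ := ∑ i, |v i|

/-- `x` is a solution of `min_u ‖y - H u‖₁`. -/
def IsL1Solution {n m : ℕ} (H : Matrix (Fin n) (Fin m) ℝ) (y : Fin n → ℝ)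
    (x : Fin m → ℝ) : Prop :=
  ∀ u : Fin m → ℝ, l1Norm (y - H.mulVec x) ≤ l1Norm (y - H.mulVec u)

/-- Every `x` is the unique `ℓ₁` solution for the observation `H x + e`, for every error `e` whose
support has at most `s` elements (`s` a real number). -/
def RecoversAll {n m : ℕ} (H : Matrix (Fin n) (Fin m) ℝ) (s : ℝ) : Prop :=
  ∀ (x : Fin m → ℝ) (e : Fin n → ℝ),
    ((Finset.univ.filter fun i => e i ≠ 0).card : ℝ) ≤ s →
      IsL1Solution H (H.mulVec x + e) x ∧
        ∀ x' : Fin m → ℝ, IsL1Solution H (H.mulVec x + e) x' → x' = x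

end ToeplitzL1

/-! Recovery follows from a null space property: for every unit `z` and every support `K` with `|K|
≤ βn`, the rows of `Hz` in `K` have smaller `ℓ₁` mass than those outside.

Fix `z` and `K`. The mass on `K` is at most `√m` times the sum of `|h_l|` over the at most `mβn`
variables occurring in rows of `K`. The mass off `K` is at least that of a maximal set `I` of rows
at mutual distance, and distance from `K`, at least `m`. Rows of `I` share no variable with each
other or with `K`, so they give independent `N(0,1)` values, independent of the variables of `K`;
maximality gives `|I| ≥ n/(2m-1) - |K|` (`exists_separated_finset`). A Chernoff bound at parameter
`μ` produces the two brackets of the rate exponent (`measureReal_row_sums_le`), and the union over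
`K` costs `exp(n · binEntropy β)`, which needs `β ≤ 1/2` (`IsAdmissible.lt_half`).

To treat all `z` at once, the Chernoff bound is proved with an additive slack `τn`. Since `∑ |h_l| ≤
cn` off an exponentially small event, this slack pays for replacing `z` by a point of a finite net
whose mesh does not depend on `n` (`recoversAll_of_net`). -/

namespace ToeplitzL1

/-! ### Exponential moments of `|N(0,1)|` -/

/-- The moment generating function of the absolute value of a standard Gaussian variable. -/
noncomputable def absGaussianMGF (t : ℝ) : ℝ := 2 * Real.exp (t ^ 2 / 2) * Phi t

lemma gaussianPDFReal_std (x : ℝ) :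
    gaussianPDFReal 0 1 x = 1 / Real.sqrt (2 * Real.pi) * Real.exp (-x ^ 2 / 2) := by
  simp [gaussianPDFReal]

lemma Phi_eq_integral (t : ℝ) : Phi t = ∫ x in Set.Iic t, gaussianPDFReal 0 1 x := by
  simp only [Phi, gaussianPDFReal_std, integral_const_mul]

lemma gaussianPDFReal_std_neg (x : ℝ) : gaussianPDFReal 0 1 (-x) = gaussianPDFReal 0 1 x := by
  simp [gaussianPDFReal_std]

lemma integral_Ioi_gaussianPDFReal (t : ℝ) :
    ∫ x in Set.Ioi t, gaussianPDFReal 0 1 x = Phi (-t) := by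
  rw [Phi_eq_integral, ← neg_neg t, ← integral_comp_neg_Iic, neg_neg]
  simp only [gaussianPDFReal_std_neg]

lemma Phi_neg (t : ℝ) : Phi (-t) = 1 - Phi t := by
  rw [← integral_Ioi_gaussianPDFReal, Phi_eq_integral, eq_sub_iff_add_eq', ← Set.compl_Iic,
    integral_add_compl measurableSet_Iic (integrable_gaussianPDFReal 0 1),
    integral_gaussianPDFReal_eq_one 0 one_ne_zero]

lemma integrable_exp_mul_abs_gaussian (t : ℝ) :
    Integrable (fun x : ℝ => Real.exp (t * |x|)) (gaussianReal 0 1) :=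
  integrable_exp_mul_abs (integrable_exp_mul_gaussianReal t) (integrable_exp_mul_gaussianReal (-t))

/-- Fold onto the half-line, complete the square, and shift by `t`. -/
lemma integral_exp_mul_abs_gaussian (t : ℝ) :
    ∫ x, Real.exp (t * |x|) ∂(gaussianReal 0 1) = absGaussianMGF t := by
  rw [integral_gaussianReal_eq_integral_smul one_ne_zero]
  have h1 : ∀ x : ℝ, gaussianPDFReal 0 1 x • Real.exp (t * |x|)
      = (fun y => Real.exp (t ^ 2 / 2) * gaussianPDFReal 0 1 (y - t)) |x| := by
    intro x
    have : gaussianPDFReal 0 1 x = gaussianPDFReal 0 1 |x| := by simp [gaussianPDFReal_std]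
    rw [this]
    simp only [gaussianPDFReal_std, smul_eq_mul]
    rw [mul_left_comm, mul_assoc, ← Real.exp_add, ← Real.exp_add]
    congr 2
    ring
  simp_rw [h1]
  rw [integral_comp_abs (f := fun y => Real.exp (t ^ 2 / 2) * gaussianPDFReal 0 1 (y - t)),
    integral_const_mul]
  have h2 : ∫ x in Set.Ioi (0 : ℝ), gaussianPDFReal 0 1 (x - t) = Phi t := by
    have := (measurePreserving_sub_right (volume : Measure ℝ) t).setIntegral_preimage_emb
      (MeasurableEquiv.subRight t).measurableEmbedding (gaussianPDFReal 0 1) (Set.Ioi (-t))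
    simp only [Set.preimage_sub_const_Ioi, neg_add_cancel] at this
    rw [this, integral_Ioi_gaussianPDFReal, neg_neg]
  rw [h2, absGaussianMGF]
  ring

lemma absGaussianMGF_zero : absGaussianMGF 0 = 1 := by
  rw [← integral_exp_mul_abs_gaussian]; simp

lemma absGaussianMGF_mono : Monotone absGaussianMGF := by
  intro s t hst
  rw [← integral_exp_mul_abs_gaussian, ← integral_exp_mul_abs_gaussian]
  refine integral_mono (integrable_exp_mul_abs_gaussian s) (integrable_exp_mul_abs_gaussian t) ?_
  intro x
  exact Real.exp_le_exp.2 (mul_le_mul_of_nonneg_right hst (abs_nonneg x))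

lemma absGaussianMGF_pos (t : ℝ) : 0 < absGaussianMGF t := by
  rw [← integral_exp_mul_abs_gaussian]
  exact integral_exp_pos (integrable_exp_mul_abs_gaussian t)

lemma Phi_pos (t : ℝ) : 0 < Phi t := by
  have := absGaussianMGF_pos t
  rw [absGaussianMGF] at this
  exact pos_of_mul_pos_right this (by positivity)

lemma one_le_absGaussianMGF {t : ℝ} (ht : 0 ≤ t) : 1 ≤ absGaussianMGF t :=
  absGaussianMGF_zero ▸ absGaussianMGF_mono ht

lemma absGaussianMGF_neg_le_one {t : ℝ} (ht : 0 ≤ t) : absGaussianMGF (-t) ≤ 1 :=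
  absGaussianMGF_zero ▸ absGaussianMGF_mono (neg_nonpos.2 ht)

lemma absGaussianMGF_neg_lt_one {t : ℝ} (ht : 0 < t) : absGaussianMGF (-t) < 1 := by
  have hint : Integrable (fun x : ℝ => 1 - Real.exp (-t * |x|)) (gaussianReal 0 1) :=
    (integrable_const _).sub (integrable_exp_mul_abs_gaussian _)
  have h1 : 0 < ∫ x, (1 - Real.exp (-t * |x|)) ∂(gaussianReal 0 1) := by
    rw [integral_pos_iff_support_of_nonneg _ hint]
    · have : Function.support (fun x : ℝ => 1 - Real.exp (-t * |x|)) = {0}ᶜ := by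
        ext x
        simp only [Function.mem_support, ne_eq, Set.mem_compl_iff, Set.mem_singleton_iff]
        rw [sub_eq_zero, eq_comm, Real.exp_eq_one_iff]
        simp [ht.ne']
      have h0 := nullSingletonClass_gaussianReal (μ := 0) (v := 1) one_ne_zero
      rw [this, measure_compl (measurableSet_singleton _) (measure_ne_top _ _)]
      simp
    · intro x
      have : -t * |x| ≤ 0 := by nlinarith [abs_nonneg x]
      simpa using this
  rw [integral_sub (integrable_const _) (integrable_exp_mul_abs_gaussian _),
    integral_exp_mul_abs_gaussian] at h1
  simpa using h1

/-- For `s = t` this is Cauchy-Schwarz, obtained by integrating `2 ≤ y + y⁻¹` with `y = c * exp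
(s|x|)` and taking `c = A⁻¹`; monotonicity gives the rest. -/
lemma one_le_absGaussianMGF_mul {s t : ℝ} (hst : s ≤ t) :
    1 ≤ absGaussianMGF t * absGaussianMGF (-s) := by
  set A := absGaussianMGF s
  set B := absGaussianMGF (-s)
  have hA : 0 < A := absGaussianMGF_pos s
  have hB : 0 < B := absGaussianMGF_pos (-s)
  have key : ∀ c : ℝ, 0 < c → 2 ≤ c * A + c⁻¹ * B := by
    intro c hc
    have h2 : ∫ _, (2 : ℝ) ∂(gaussianReal 0 1) = 2 := by simp
    rw [← h2]
    simp only [A, B, ← integral_exp_mul_abs_gaussian]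
    rw [← integral_const_mul, ← integral_const_mul, ← integral_add
      ((integrable_exp_mul_abs_gaussian _).const_mul _)
      ((integrable_exp_mul_abs_gaussian _).const_mul _)]
    refine integral_mono (integrable_const _) (((integrable_exp_mul_abs_gaussian _).const_mul _).add
      ((integrable_exp_mul_abs_gaussian _).const_mul _)) fun x => ?_
    have hp : 0 < c * Real.exp (s * |x|) := by positivity
    have : c⁻¹ * Real.exp (-s * |x|) = (c * Real.exp (s * |x|))⁻¹ := by
      rw [mul_inv, ← Real.exp_neg, neg_mul]
    simp only [this]
    set y := c * Real.exp (s * |x|)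
    have h3 : y * y⁻¹ = 1 := mul_inv_cancel₀ hp.ne'
    have h4 : 0 < y⁻¹ := inv_pos.2 hp
    nlinarith [sq_nonneg (y - y⁻¹)]
  have h5 := key A⁻¹ (inv_pos.2 hA)
  rw [inv_mul_cancel₀ hA.ne', inv_inv] at h5
  have h6 : A ≤ absGaussianMGF t := absGaussianMGF_mono hst
  nlinarith

/-! ### The rate exponent and admissible `β` -/

lemma log_absGaussianMGF (t : ℝ) :
    Real.log (absGaussianMGF t) = Real.log 2 + t ^ 2 / 2 + Real.log (Phi t) := by
  rw [absGaussianMGF, Real.log_mul (by positivity) (Phi_pos t).ne',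
    Real.log_mul two_ne_zero (Real.exp_ne_zero _), Real.log_exp]

/-- Since `1 - Φ(s) = Φ(-s)`, both brackets are logarithmic moments, at `μ√m` and at `-μ(1-δ)`: the
form in which the Chernoff bound yields them. -/
lemma rateExponent_eq (m : ℕ) (β μ δ : ℝ) :
    rateExponent m β μ δ = Real.binEntropy β
      + m * β * Real.log (absGaussianMGF (μ * Real.sqrt m))
      + (1 / (2 * (m : ℝ) - 1) - β) * Real.log (absGaussianMGF (-(μ * (1 - δ)))) := by
  rw [rateExponent, log_absGaussianMGF, log_absGaussianMGF, Phi_neg, Real.binEntropy, mul_pow,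
    Real.sq_sqrt (Nat.cast_nonneg m), one_div, one_div, neg_sq, mul_pow]
  ring_nf

/-- At `β = 0` only the negative tail term survives, and the exponent is continuous in `β`. -/
lemma exists_isAdmissible {m : ℕ} (hm : 0 < m) : ∃ β, IsAdmissible m β := by
  have hm' : (1 : ℝ) ≤ m := by exact_mod_cast hm
  have hcont : Continuous fun β => rateExponent m β 1 (1 / 2) := by
    simp only [rateExponent_eq]
    exact (Real.binEntropy_continuous.add (by fun_prop)).add (by fun_prop)
  have h0 : rateExponent m 0 1 (1 / 2) < 0 := by
    rw [rateExponent_eq]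
    simp only [Real.binEntropy_zero, mul_zero, zero_mul, zero_add, sub_zero]
    exact mul_neg_of_pos_of_neg (by apply one_div_pos.2; linarith)
      (Real.log_neg (absGaussianMGF_pos _) (absGaussianMGF_neg_lt_one (by norm_num)))
  have h1 := (hcont.tendsto 0).eventually (gt_mem_nhds h0)
  have h2 : ∀ᶠ β : ℝ in nhdsWithin 0 (Set.Ioi 0), 0 < β ∧ β < 1 :=
    Ioo_mem_nhdsGT one_pos
  obtain ⟨β, h3, h4, h5⟩ := ((h1.filter_mono nhdsWithin_le_nhds).and h2).exists
  exact ⟨β, h4, h5, 1, 1 / 2, one_pos, by norm_num, by norm_num, h3⟩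

/-- If `β ≥ 1/2`, then `1/(2m-1) - β ≤ β`, so the exponent is at least `binEntropy β + β(U + V)`,
and `U + V ≥ 0` by `one_le_absGaussianMGF_mul`. -/
lemma IsAdmissible.lt_half {m : ℕ} (hm : 0 < m) {β : ℝ} (h : IsAdmissible m β) : β < 1 / 2 := by
  obtain ⟨h0, h1, μ, δ, hμ, hδ0, hδ1, h⟩ := h
  by_contra! hβ
  have hm' : (1 : ℝ) ≤ m := by exact_mod_cast hm
  rw [rateExponent_eq] at h
  have hH := Real.binEntropy_nonneg h0.le h1.le
  have hle : μ * (1 - δ) ≤ μ * Real.sqrt m := by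
    have : 1 ≤ Real.sqrt m := Real.one_le_sqrt.2 hm'
    exact mul_le_mul_of_nonneg_left (by linarith) hμ.le
  have hs : 0 ≤ μ * (1 - δ) := mul_nonneg hμ.le (by linarith)
  set U := Real.log (absGaussianMGF (μ * Real.sqrt m)) with hU
  set V := Real.log (absGaussianMGF (-(μ * (1 - δ)))) with hV
  have hUV : 0 ≤ U + V := by
    rw [hU, hV, ← Real.log_mul (absGaussianMGF_pos _).ne' (absGaussianMGF_pos _).ne']
    exact Real.log_nonneg (one_le_absGaussianMGF_mul hle)
  have hV0 : V ≤ 0 := Real.log_nonpos (absGaussianMGF_pos _).le (absGaussianMGF_neg_le_one hs)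
  have hU0 : 0 ≤ U := Real.log_nonneg (one_le_absGaussianMGF (by positivity))
  have h2 : 1 / (2 * (m : ℝ) - 1) - β ≤ β := by
    have : 1 / (2 * (m : ℝ) - 1) ≤ 1 := by
      rw [div_le_one (by linarith)]; linarith
    linarith
  have h3 : β * V ≤ (1 / (2 * (m : ℝ) - 1) - β) * V := mul_le_mul_of_nonpos_right h2 hV0
  have h4 : β * U ≤ m * β * U := by
    have : 0 ≤ β * U := by positivity
    nlinarith
  nlinarith

/-! ### Factoring moments over disjoint blocks of variables -/

section Independence

variable {Ω ι κ : Type*} [MeasurableSpace Ω] {P : Measure Ω} {X : ι → Ω → ℝ}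

lemma lintegral_mul_of_dependsOn_disjoint (hX : ∀ i, AEMeasurable (X i) P) (hI : iIndepFun X P)
    {A B : Finset ι} (hAB : Disjoint A B) {f g : (ι → ℝ) → ENNReal} (hf : Measurable f)
    (hg : Measurable g) (hfA : DependsOn f (A : Set ι)) (hgB : DependsOn g (B : Set ι)) :
    ∫⁻ ω, f (fun i => X i ω) * g (fun i => X i ω) ∂P
      = (∫⁻ ω, f (fun i => X i ω) ∂P) * ∫⁻ ω, g (fun i => X i ω) ∂P := by
  classical
  -- Extension by zero off `S`; the filler value is immaterial to a function depending only on `S`.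
  let ext (S : Finset ι) (x : S → ℝ) (i : ι) : ℝ := if h : i ∈ S then x ⟨i, h⟩ else 0
  have hext : ∀ S, Measurable (ext S) := by
    intro S
    refine measurable_pi_lambda _ fun i => ?_
    by_cases h : i ∈ S
    · simpa [ext, h] using measurable_pi_apply _
    · simp [ext, h]
  have hres : ∀ (S : Finset ι) (φ : (ι → ℝ) → ENNReal), DependsOn φ (S : Set ι) →
      (fun ω => φ (fun i => X i ω)) = (φ ∘ ext S) ∘ fun ω (i : S) => X i ω := by
    intro S φ hφ
    funext ω
    refine hφ fun i hi => ?_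
    have : i ∈ S := hi
    simp [ext, this]
  have hm : ∀ (S : Finset ι), AEMeasurable (fun ω (i : S) => X i ω) P := fun S =>
    aemeasurable_pi_lambda _ fun i => hX i
  rw [hres A f hfA, hres B g hgB]
  have h1 := (hI.indepFun_finset₀ A B hAB hX).comp (hf.comp (hext A)) (hg.comp (hext B))
  have h2 := lintegral_mul_eq_lintegral_mul_lintegral_of_indepFun''
    ((hf.comp (hext A)).comp_aemeasurable (hm A)) ((hg.comp (hext B)).comp_aemeasurable (hm B)) h1
  rw [← h2]
  refine lintegral_congr fun ω => ?_
  rw [← congrFun (hres A f hfA) ω, ← congrFun (hres B g hgB) ω]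

lemma dependsOn_finset_prod [DecidableEq ι] {I : Finset κ} {B : κ → Finset ι}
    {f : κ → (ι → ℝ) → ENNReal} (hf : ∀ i ∈ I, DependsOn (f i) (B i : Set ι)) :
    DependsOn (fun x => ∏ i ∈ I, f i x) (I.biUnion B : Set ι) := by
  intro x y hxy
  refine Finset.prod_congr rfl fun i hi => hf i hi fun k hk => hxy k ?_
  exact Finset.mem_coe.2 (Finset.mem_biUnion.2 ⟨i, hi, hk⟩)

lemma lintegral_prod_of_dependsOn_pairwiseDisjoint [IsProbabilityMeasure P]
    (hX : ∀ i, AEMeasurable (X i) P) (hI : iIndepFun X P) (I : Finset κ) {B : κ → Finset ι}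
    (hB : (I : Set κ).PairwiseDisjoint B) {f : κ → (ι → ℝ) → ENNReal}
    (hf : ∀ i, Measurable (f i)) (hfB : ∀ i ∈ I, DependsOn (f i) (B i : Set ι)) :
    ∫⁻ ω, ∏ i ∈ I, f i (fun k => X k ω) ∂P = ∏ i ∈ I, ∫⁻ ω, f i (fun k => X k ω) ∂P := by
  classical
  induction I using Finset.induction_on with
  | empty => simp
  | insert a s ha ih =>
    simp only [Finset.prod_insert ha]
    rw [← ih (hB.subset (by simp)) fun i hi => hfB i (Finset.mem_insert_of_mem hi)]
    refine lintegral_mul_of_dependsOn_disjoint (g := fun x => ∏ i ∈ s, f i x) hX hI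
      (A := B a) (B := s.biUnion B) ?_ (hf a)
      (Finset.measurable_prod _ fun i _ => hf i) (hfB a (Finset.mem_insert_self _ _))
      (dependsOn_finset_prod fun i hi => hfB i (Finset.mem_insert_of_mem hi))
    rw [Finset.disjoint_biUnion_right]
    intro i hi
    refine hB (by simp) (by simp [hi]) ?_
    rintro rfl
    exact ha hi

lemma hasLaw_sum_const_mul_gaussianReal [IsProbabilityMeasure P] [Fintype κ]
    {Z : κ → Ω → ℝ} (hZ : ∀ j, HasLaw (Z j) (gaussianReal 0 1) P) (hI : iIndepFun Z P)
    {v : κ → ℝ} (hv : ∑ j, v j ^ 2 = 1) :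
    HasLaw (fun ω => ∑ j, v j * Z j ω) (gaussianReal 0 1) P := by
  classical
  have hI' : iIndepFun (fun j ω => v j * Z j ω) P :=
    hI.comp (fun j x => v j * x) fun j => measurable_const_mul _
  have hm : ∀ j, AEMeasurable (fun ω => v j * Z j ω) P := fun j =>
    (hZ j).aemeasurable.const_mul _
  have key : ∀ s : Finset κ, HasLaw (∑ j ∈ s, fun ω => v j * Z j ω)
      (gaussianReal 0 (∑ j ∈ s, .mk (v j ^ 2) (sq_nonneg _))) P := by
    intro s
    induction s using Finset.induction_on with
    | empty =>
      simp only [Finset.sum_empty, gaussianReal_zero_var]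
      exact hasLaw_dirac_of_ae_eq (Filter.Eventually.of_forall fun ω => rfl)
    | insert a s ha ih =>
      rw [Finset.sum_insert ha, Finset.sum_insert ha]
      refine ⟨(hm a).add ih.aemeasurable, ?_⟩
      have h1 := gaussianReal_const_mul (hZ a) (v a)
      have h2 := gaussianReal_add_gaussianReal_of_indepFun
        (hI'.indepFun_finsetSum_of_notMem₀ hm ha).symm h1.map_eq ih.map_eq
      simpa using h2
  have h := key Finset.univ
  have hvar : (∑ j, NNReal.mk (v j ^ 2) (sq_nonneg _)) = 1 := by
    apply NNReal.coe_injective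
    rw [NNReal.coe_sum]
    exact hv
  rw [hvar] at h
  convert h using 1
  funext ω
  simp

lemma lintegral_exp_mul_abs_of_hasLaw {Y : Ω → ℝ} (hY : HasLaw Y (gaussianReal 0 1) P) (t : ℝ) :
    ∫⁻ ω, ENNReal.ofReal (Real.exp (t * |Y ω|)) ∂P = ENNReal.ofReal (absGaussianMGF t) := by
  rw [← integral_exp_mul_abs_gaussian, ofReal_integral_eq_lintegral_ofReal
    (integrable_exp_mul_abs_gaussian t) (Filter.Eventually.of_forall fun _ => (Real.exp_pos _).le)]
  exact hY.lintegral_comp (f := fun x => ENNReal.ofReal (Real.exp (t * |x|))) (by fun_prop)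

lemma measurable_ofReal_exp_mul_abs (t : ℝ) :
    Measurable fun x : ℝ => ENNReal.ofReal (Real.exp (t * |x|)) := by fun_prop

/-- The exponential moment of a combination of absolute values of independent Gaussians over `L`
and of disjoint unit linear combinations indexed by `I`. -/
lemma lintegral_exp_abs_sum_add [IsProbabilityMeasure P] {μ : Type*} [Fintype μ]
    (hX : ∀ i, HasLaw (X i) (gaussianReal 0 1) P) (hI : iIndepFun X P)
    (L : Finset ι) (I : Finset κ) (idx : κ → μ → ι) (hidx : ∀ i, Function.Injective (idx i))
    (hIdisj : ∀ i ∈ I, ∀ i' ∈ I, i ≠ i' → ∀ j j', idx i j ≠ idx i' j')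
    (hIL : ∀ i ∈ I, ∀ j, idx i j ∉ L) {v : μ → ℝ} (hv : ∑ j, v j ^ 2 = 1) (s t : ℝ) :
    ∫⁻ ω, ENNReal.ofReal (Real.exp (s * ∑ l ∈ L, |X l ω|
        + t * ∑ i ∈ I, |∑ j, v j * X (idx i j) ω|)) ∂P
      = ENNReal.ofReal (absGaussianMGF s ^ L.card * absGaussianMGF t ^ I.card) := by
  classical
  have hXm := fun i => (hX i).aemeasurable
  let B : κ → Finset ι := fun i => Finset.univ.image (idx i)
  let f : ι → (ι → ℝ) → ENNReal := fun l x => ENNReal.ofReal (Real.exp (s * |x l|))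
  let g : κ → (ι → ℝ) → ENNReal := fun i x =>
    ENNReal.ofReal (Real.exp (t * |∑ j, v j * x (idx i j)|))
  have hf : ∀ l, Measurable (f l) := fun l =>
    (measurable_ofReal_exp_mul_abs s).comp (measurable_pi_apply l)
  have hg : ∀ i, Measurable (g i) := fun i =>
    (measurable_ofReal_exp_mul_abs t).comp
      (Finset.measurable_sum _ fun j _ => (measurable_pi_apply (idx i j)).const_mul _)
  have hfd : ∀ l ∈ L, DependsOn (f l) (({l} : Finset ι) : Set ι) := by
    intro l _ x y hxy
    simp only [f, hxy l (by simp)]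
  have hgd : ∀ i ∈ I, DependsOn (g i) (B i : Set ι) := by
    intro i _ x y hxy
    have : ∀ j, x (idx i j) = y (idx i j) := fun j => hxy _ (by simp [B])
    simp only [g, this]
  have hprod : ∀ ω, ENNReal.ofReal (Real.exp (s * ∑ l ∈ L, |X l ω|
        + t * ∑ i ∈ I, |∑ j, v j * X (idx i j) ω|))
      = (∏ l ∈ L, f l fun k => X k ω) * ∏ i ∈ I, g i fun k => X k ω := by
    intro ω
    rw [Real.exp_add, ENNReal.ofReal_mul (Real.exp_pos _).le, Finset.mul_sum, Finset.mul_sum,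
      Real.exp_sum, Real.exp_sum, ENNReal.ofReal_prod_of_nonneg fun _ _ => (Real.exp_pos _).le,
      ENNReal.ofReal_prod_of_nonneg fun _ _ => (Real.exp_pos _).le]
  simp_rw [hprod]
  rw [lintegral_mul_of_dependsOn_disjoint (f := fun x => ∏ l ∈ L, f l x)
    (g := fun x => ∏ i ∈ I, g i x) hXm hI (A := L.biUnion fun l => {l}) (B := I.biUnion B) ?_
    (Finset.measurable_prod _ fun i _ => hf i) (Finset.measurable_prod _ fun i _ => hg i)
    (dependsOn_finset_prod hfd) (dependsOn_finset_prod hgd),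
    lintegral_prod_of_dependsOn_pairwiseDisjoint hXm hI L (B := fun l => {l}) ?_ hf hfd,
    lintegral_prod_of_dependsOn_pairwiseDisjoint hXm hI I (B := B) ?_ hg hgd]
  · have h1 : ∀ l, ∫⁻ ω, f l (fun k => X k ω) ∂P = ENNReal.ofReal (absGaussianMGF s) := fun l =>
      lintegral_exp_mul_abs_of_hasLaw (hX l) s
    have h2 : ∀ i, ∫⁻ ω, g i (fun k => X k ω) ∂P = ENNReal.ofReal (absGaussianMGF t) := fun i =>
      lintegral_exp_mul_abs_of_hasLaw (hasLaw_sum_const_mul_gaussianReal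
        (fun j => hX (idx i j)) (hI.precomp (hidx i)) hv) t
    simp only [h1, h2, Finset.prod_const]
    rw [ENNReal.ofReal_mul (pow_nonneg (absGaussianMGF_pos s).le _),
      ENNReal.ofReal_pow (absGaussianMGF_pos s).le, ENNReal.ofReal_pow (absGaussianMGF_pos t).le]
  · intro i hi i' hi' hne
    rw [Function.onFun, Finset.disjoint_left]
    simp only [B, Finset.mem_image, Finset.mem_univ, true_and]
    rintro _ ⟨j, rfl⟩ ⟨j', h⟩
    exact hIdisj i hi i' hi' hne j j' h.symm
  · intro l _ l' _ hne
    simpa [Function.onFun] using hne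
  · rw [Finset.biUnion_singleton_eq_self, Finset.disjoint_biUnion_right]
    intro i hi
    rw [Finset.disjoint_left]
    simp only [B, Finset.mem_image, Finset.mem_univ, true_and]
    rintro _ hl ⟨j, rfl⟩
    exact hIL i hi j hl

end Independence

/-! ### Separated rows and the number of supports -/

/-- Every set `K` of positions can be completed by an `m`-separated set `I`, itself `m`-separated
from `K`, so that the neighbourhoods of radius `m - 1` cover all positions. -/
lemma exists_separated_finset {n m : ℕ} (hm : 0 < m) (K : Finset (Fin n)) :
    ∃ I : Finset (Fin n),
      (∀ i ∈ I, ∀ i' ∈ I, i ≠ i' → (m : ℤ) ≤ |((i : ℕ) : ℤ) - ((i' : ℕ) : ℤ)|) ∧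
      (∀ i ∈ I, ∀ k ∈ K, (m : ℤ) ≤ |((i : ℕ) : ℤ) - ((k : ℕ) : ℤ)|) ∧
      n ≤ (I.card + K.card) * (2 * m - 1) := by
  classical
  let S : Finset (Finset (Fin n)) := Finset.univ.filter fun I =>
    (∀ i ∈ I, ∀ i' ∈ I, i ≠ i' → (m : ℤ) ≤ |((i : ℕ) : ℤ) - ((i' : ℕ) : ℤ)|) ∧
      (∀ i ∈ I, ∀ k ∈ K, (m : ℤ) ≤ |((i : ℕ) : ℤ) - ((k : ℕ) : ℤ)|)
  -- With `I` of maximal size, an uncovered position could be added to it.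
  obtain ⟨I, hIS, hmax⟩ := Finset.exists_max_image S Finset.card ⟨∅, by simp [S]⟩
  obtain ⟨h1, h2⟩ := (Finset.mem_filter.1 hIS).2
  refine ⟨I, h1, h2, ?_⟩
  let nb : Fin n → Finset (Fin n) := fun c => Finset.univ.filter fun i =>
    |((i : ℕ) : ℤ) - ((c : ℕ) : ℤ)| < m
  have hcover : (Finset.univ : Finset (Fin n)) ⊆ (I ∪ K).biUnion nb := by
    intro i _
    by_contra hi
    have hfar : ∀ c ∈ I ∪ K, (m : ℤ) ≤ |((i : ℕ) : ℤ) - ((c : ℕ) : ℤ)| := by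
      intro c hc
      by_contra! hlt
      exact hi (Finset.mem_biUnion.2 ⟨c, hc, Finset.mem_filter.2 ⟨Finset.mem_univ _, hlt⟩⟩)
    have hiI : i ∉ I := fun h => by
      have := hfar i (Finset.mem_union_left _ h)
      simp at this
      omega
    have hins : insert i I ∈ S := by
      refine Finset.mem_filter.2 ⟨Finset.mem_univ _, ?_, ?_⟩
      · intro a ha b hb hab
        rcases Finset.mem_insert.1 ha with rfl | haI
        · rcases Finset.mem_insert.1 hb with rfl | hb
          · exact absurd rfl hab
          · exact hfar b (Finset.mem_union_left _ hb)
        · rcases Finset.mem_insert.1 hb with rfl | hb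
          · rw [abs_sub_comm]
            exact hfar a (Finset.mem_union_left _ haI)
          · exact h1 a haI b hb hab
      · intro a ha k hk
        rcases Finset.mem_insert.1 ha with rfl | ha
        · exact hfar k (Finset.mem_union_right _ hk)
        · exact h2 a ha k hk
    have := hmax _ hins
    rw [Finset.card_insert_of_notMem hiI] at this
    omega
  have hnb : ∀ c ∈ I ∪ K, (nb c).card ≤ 2 * m - 1 := by
    intro c _
    have hinj : Set.InjOn (fun i : Fin n => ((i : ℕ) : ℤ)) (nb c) := by
      intro a _ b _ hab
      simpa [Fin.ext_iff] using hab
    have hmaps : Set.MapsTo (fun i : Fin n => ((i : ℕ) : ℤ)) (nb c)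
        (Finset.Ioo (((c : ℕ) : ℤ) - m) (((c : ℕ) : ℤ) + m)) := by
      intro i hi
      have := abs_lt.1 (Finset.mem_filter.1 hi).2
      simp only [Finset.coe_Ioo, Set.mem_Ioo]
      constructor <;> linarith
    have := Finset.card_le_card_of_injOn _ hmaps hinj
    rw [Int.card_Ioo] at this
    omega
  calc n = (Finset.univ : Finset (Fin n)).card := by simp
    _ ≤ ((I ∪ K).biUnion nb).card := Finset.card_le_card hcover
    _ ≤ (I ∪ K).card * (2 * m - 1) := Finset.card_biUnion_le_card_mul _ _ _ hnb
    _ ≤ (I.card + K.card) * (2 * m - 1) := Nat.mul_le_mul_right _ (Finset.card_union_le _ _)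

/-- The Bernoulli weights `β^|K| (1-β)^(n-|K|)` sum to 1, and as `β ≤ 1 - β` each `K` counted has
weight at least `exp(-n · binEntropy β)`. -/
lemma card_filter_card_le_exp_binEntropy (n : ℕ) {β : ℝ} (h0 : 0 < β) (h1 : β ≤ 1 / 2) :
    (((Finset.univ : Finset (Finset (Fin n))).filter fun K => (K.card : ℝ) ≤ β * n).card : ℝ)
      ≤ Real.exp (n * Real.binEntropy β) := by
  set T := (Finset.univ : Finset (Finset (Fin n))).filter fun K => (K.card : ℝ) ≤ β * n
  have hβ1 : 0 < 1 - β := by linarith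
  have hterm : ∀ K ∈ T, Real.exp (-(n * Real.binEntropy β))
      ≤ β ^ K.card * (1 - β) ^ (n - K.card) := by
    intro K hK
    have hK' : (K.card : ℝ) ≤ β * n := (Finset.mem_filter.1 hK).2
    have hKn : K.card ≤ n := by simpa using Finset.card_le_univ K
    rw [← Real.exp_log (show 0 < β ^ K.card * (1 - β) ^ (n - K.card) by positivity)]
    refine Real.exp_le_exp.2 ?_
    rw [Real.log_mul (by positivity) (by positivity), Real.log_pow, Real.log_pow,
      Nat.cast_sub hKn, Real.binEntropy, Real.log_inv, Real.log_inv]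
    have hlog : Real.log β ≤ Real.log (1 - β) := Real.log_le_log h0 (by linarith)
    nlinarith
  have hsum : ∑ K : Finset (Fin n), β ^ K.card * (1 - β) ^ (n - K.card) = 1 := by
    have := Finset.sum_pow_mul_eq_add_pow β (1 - β) (Finset.univ : Finset (Fin n))
    simpa using this
  have hle : (T.card : ℝ) * Real.exp (-(n * Real.binEntropy β)) ≤ 1 := by
    rw [← hsum, ← nsmul_eq_mul]
    refine (Finset.card_nsmul_le_sum _ _ _ hterm).trans ?_
    exact Finset.sum_le_sum_of_subset_of_nonneg (Finset.subset_univ _)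
      fun K _ _ => by positivity
  rw [Real.exp_neg, ← div_eq_mul_inv, div_le_one (Real.exp_pos _)] at hle
  exact hle

/-! ### From the null space property to recovery -/

lemma l1Norm_lt_l1Norm_sub {n : ℕ} {K : Finset (Fin n)} {e w : Fin n → ℝ}
    (he : ∀ i ∉ K, e i = 0) (hw : ∑ i ∈ K, |w i| < ∑ i ∈ Kᶜ, |w i|) :
    l1Norm e < l1Norm (e - w) := by
  simp only [l1Norm, Pi.sub_apply]
  rw [← Finset.sum_add_sum_compl K, ← Finset.sum_add_sum_compl K (fun i => |e i - w i|)]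
  have h1 : ∑ i ∈ Kᶜ, |e i| = 0 := Finset.sum_eq_zero fun i hi => by
    rw [he i (Finset.mem_compl.1 hi), abs_zero]
  have h2 : ∑ i ∈ Kᶜ, |e i - w i| = ∑ i ∈ Kᶜ, |w i| := Finset.sum_congr rfl fun i hi => by
    rw [he i (Finset.mem_compl.1 hi), zero_sub, abs_neg]
  have h3 : ∑ i ∈ K, |e i| ≤ ∑ i ∈ K, |e i - w i| + ∑ i ∈ K, |w i| := by
    rw [← Finset.sum_add_distrib]
    refine Finset.sum_le_sum fun i _ => ?_
    have := abs_add_le (e i - w i) (w i)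
    simpa using this
  linarith

/-- The null space property on the unit sphere implies recovery. -/
lemma recoversAll_of_nullSpaceProperty {n m : ℕ} {H : Matrix (Fin n) (Fin m) ℝ} {s : ℝ}
    (hH : ∀ K : Finset (Fin n), (K.card : ℝ) ≤ s → ∀ z : Fin m → ℝ, ∑ j, z j ^ 2 = 1 →
      ∑ i ∈ K, |H.mulVec z i| < ∑ i ∈ Kᶜ, |H.mulVec z i|) : RecoversAll H s := by
  classical
  intro x e he
  have key : ∀ u, u ≠ x →
      l1Norm (H.mulVec x + e - H.mulVec x) < l1Norm (H.mulVec x + e - H.mulVec u) := by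
    intro u hu
    have hpos : 0 < ∑ j, (u - x) j ^ 2 := by
      obtain ⟨j, hj⟩ := Function.ne_iff.1 hu
      refine Finset.sum_pos' (fun j _ => sq_nonneg _) ⟨j, Finset.mem_univ _, ?_⟩
      have : (u - x) j ≠ 0 := sub_ne_zero.2 hj
      positivity
    -- Both sides are homogeneous, so `u - x` may be normalised.
    set c := Real.sqrt (∑ j, (u - x) j ^ 2) with hc
    have hcpos : 0 < c := Real.sqrt_pos.2 hpos
    have hz : ∑ j, (c⁻¹ • (u - x)) j ^ 2 = 1 := by
      simp only [Pi.smul_apply, smul_eq_mul, mul_pow]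
      rw [← Finset.mul_sum, inv_pow, hc, Real.sq_sqrt hpos.le, inv_mul_cancel₀ hpos.ne']
    have h1 := hH (Finset.univ.filter fun i => e i ≠ 0) he _ hz
    simp only [Matrix.mulVec_smul, Pi.smul_apply, smul_eq_mul, abs_mul, ← Finset.mul_sum] at h1
    have h2 := lt_of_mul_lt_mul_left h1 (abs_nonneg _)
    have h3 := l1Norm_lt_l1Norm_sub (e := e) (fun i hi => by simpa using hi) h2
    have e1 : H.mulVec x + e - H.mulVec x = e := by abel
    have e2 : H.mulVec x + e - H.mulVec u = e - H.mulVec (u - x) := by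
      rw [Matrix.mulVec_sub]; abel
    rwa [e1, e2]
  refine ⟨fun u => ?_, fun x' hx' => ?_⟩
  · by_cases hu : u = x
    · rw [hu]
    · exact (key u hu).le
  · by_contra hne
    exact absurd (hx' x) (not_le.2 (key x' hne))

lemma isCompact_setOf_sum_sq_eq_one (m : ℕ) :
    IsCompact {v : Fin m → ℝ | ∑ j, v j ^ 2 = 1} := by
  refine Metric.isCompact_of_isClosed_isBounded
    (isClosed_eq (by fun_prop) continuous_const) ?_
  refine Metric.isBounded_closedBall.subset (?_ : _ ⊆ Metric.closedBall (0 : Fin m → ℝ) 1)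
  intro v hv
  rw [Metric.mem_closedBall, dist_pi_le_iff zero_le_one]
  intro j
  have h1 : v j ^ 2 ≤ 1 :=
    (Finset.single_le_sum (f := fun j => v j ^ 2) (fun j _ => sq_nonneg _)
      (Finset.mem_univ j)).trans hv.le
  simpa using (sq_le_one_iff_abs_le_one _).1 h1

lemma sum_lt_sum_compl_of_close {α : Type*} [Fintype α] [DecidableEq α] {K : Finset α}
    {a b : α → ℝ} {d : ℝ} (h : ∑ i ∈ K, |b i| + d < ∑ i ∈ Kᶜ, |b i|)
    (hd : ∑ i, |a i - b i| ≤ d) : ∑ i ∈ K, |a i| < ∑ i ∈ Kᶜ, |a i| := by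
  rw [← Finset.sum_add_sum_compl K] at hd
  have h1 : ∑ i ∈ K, |a i| ≤ ∑ i ∈ K, |b i| + ∑ i ∈ K, |a i - b i| := by
    rw [← Finset.sum_add_distrib]
    refine Finset.sum_le_sum fun i _ => ?_
    have := abs_add_le (b i) (a i - b i)
    simpa using this
  have h2 : ∑ i ∈ Kᶜ, |b i| ≤ ∑ i ∈ Kᶜ, |a i| + ∑ i ∈ Kᶜ, |a i - b i| := by
    rw [← Finset.sum_add_distrib]
    refine Finset.sum_le_sum fun i _ => ?_
    have := abs_sub (a i) (a i - b i)
    simpa using this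
  linarith

/-! ### Chernoff and union bounds -/

section TailBounds

variable {Ω ι : Type*} [MeasurableSpace Ω] {P : Measure Ω} [IsProbabilityMeasure P]
  {X : ι → Ω → ℝ}

omit [IsProbabilityMeasure P] in
lemma measure_nonneg_le_lintegral_exp {Z : Ω → ℝ} (hZ : AEMeasurable Z P) :
    P {ω | 0 ≤ Z ω} ≤ ∫⁻ ω, ENNReal.ofReal (Real.exp (Z ω)) ∂P := by
  have h := mul_meas_ge_le_lintegral₀ (μ := P)
    (Real.measurable_exp.comp_aemeasurable hZ).ennreal_ofReal 1
  rw [one_mul] at h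
  refine (measure_mono fun ω hω => ?_).trans h
  simpa using hω

lemma measureReal_sum_abs_ge_le [Fintype ι] (hX : ∀ i, HasLaw (X i) (gaussianReal 0 1) P)
    (hI : iIndepFun X P) (c : ℝ) :
    P.real {ω | c ≤ ∑ l, |X l ω|} ≤ Real.exp (-c) * absGaussianMGF 1 ^ Fintype.card ι := by
  have hXm := fun i => (hX i).aemeasurable
  have hZ : AEMeasurable (fun ω => ∑ l, |X l ω| - c) P := by fun_prop
  have h1 := measure_nonneg_le_lintegral_exp hZ
  have h2 := lintegral_exp_abs_sum_add (κ := Fin 0) (μ := Fin 1) hX hI Finset.univ ∅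
    (fun i => i.elim0) (fun i => i.elim0) (by simp) (by simp) (v := 1) (by simp) 1 0
  simp only [Finset.sum_empty, mul_zero, add_zero, one_mul, Finset.card_empty, pow_zero,
    mul_one, Finset.card_univ] at h2
  have h3 : ∫⁻ ω, ENNReal.ofReal (Real.exp (∑ l, |X l ω| - c)) ∂P
      = ENNReal.ofReal (Real.exp (-c) * absGaussianMGF 1 ^ Fintype.card ι) := by
    rw [ENNReal.ofReal_mul (Real.exp_pos _).le, ← h2, ← lintegral_const_mul'' _ (by fun_prop)]
    refine lintegral_congr fun ω => ?_
    rw [← ENNReal.ofReal_mul (Real.exp_pos _).le, ← Real.exp_add]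
    congr 2
    ring
  rw [h3] at h1
  have h4 := ENNReal.toReal_mono ENNReal.ofReal_ne_top h1
  rw [ENNReal.toReal_ofReal (mul_nonneg (Real.exp_pos _).le
    (pow_nonneg (absGaussianMGF_pos 1).le _))] at h4
  simpa [Measure.real, sub_nonneg] using h4

lemma sum_abs_le_sqrt_of_sum_sq_eq_one {m : ℕ} {v : Fin m → ℝ} (hv : ∑ j, v j ^ 2 = 1) :
    ∑ j, |v j| ≤ Real.sqrt m := by
  refine Real.le_sqrt_of_sq_le ?_
  have := sq_sum_le_card_mul_sum_sq (s := (Finset.univ : Finset (Fin m))) (f := fun j => |v j|)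
  simpa [sq_abs, hv] using this

variable {n m : ℕ} {idx : Fin n → Fin m → ι}

/-- Within one column, distinct rows read distinct variables, so column `j` contributes at most `|v
j|` times the whole sum over `l`. -/
lemma sum_abs_rows_le [DecidableEq ι] (hidx : ∀ i j i' j', idx i j = idx i' j' →
      (i : ℕ) + (j : ℕ) = (i' : ℕ) + (j' : ℕ)) (K : Finset (Fin n)) (x : ι → ℝ) (v : Fin m → ℝ) :
    ∑ i ∈ K, |∑ j, v j * x (idx i j)|
      ≤ (∑ j, |v j|) * ∑ l ∈ K.biUnion (fun i => Finset.univ.image (idx i)), |x l| := by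
  calc ∑ i ∈ K, |∑ j, v j * x (idx i j)|
      ≤ ∑ i ∈ K, ∑ j, |v j| * |x (idx i j)| := by
        refine Finset.sum_le_sum fun i _ => (Finset.abs_sum_le_sum_abs _ _).trans ?_
        simp only [abs_mul, le_refl]
    _ = ∑ j, |v j| * ∑ i ∈ K, |x (idx i j)| := by
        rw [Finset.sum_comm]
        simp only [Finset.mul_sum]
    _ ≤ ∑ j, |v j| * ∑ l ∈ K.biUnion (fun i => Finset.univ.image (idx i)), |x l| := by
        refine Finset.sum_le_sum fun j _ => mul_le_mul_of_nonneg_left ?_ (abs_nonneg _)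
        have hinj : Set.InjOn (fun i => idx i j) K := by
          intro a _ b _ hab
          have := hidx a j b j hab
          exact Fin.ext (by omega)
        rw [← Finset.sum_image (f := fun l => |x l|) hinj]
        refine Finset.sum_le_sum_of_subset_of_nonneg ?_ fun _ _ _ => abs_nonneg _
        intro l hl
        obtain ⟨i, hi, rfl⟩ := Finset.mem_image.1 hl
        exact Finset.mem_biUnion.2 ⟨i, hi, Finset.mem_image_of_mem _ (Finset.mem_univ j)⟩
    _ = _ := by rw [Finset.sum_mul]

/-- Chernoff bound for one direction `v` and one error support `K`. -/
lemma measureReal_row_sums_le (hm : 0 < m) (hX : ∀ i, HasLaw (X i) (gaussianReal 0 1) P)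
    (hI : iIndepFun X P) (hidx : ∀ i j i' j', idx i j = idx i' j' →
      (i : ℕ) + (j : ℕ) = (i' : ℕ) + (j' : ℕ)) {v : Fin m → ℝ} (hv : ∑ j, v j ^ 2 = 1)
    {μ δ β : ℝ} (hμ : 0 < μ) (hδ : δ < 1) (K : Finset (Fin n)) (hK : (K.card : ℝ) ≤ β * n)
    (τ : ℝ) :
    P.real {ω | (1 - δ) * ∑ i ∈ Kᶜ, |∑ j, v j * X (idx i j) ω|
        ≤ ∑ i ∈ K, |∑ j, v j * X (idx i j) ω| + τ * n}
      ≤ Real.exp (n * (μ * τ + m * β * Real.log (absGaussianMGF (μ * Real.sqrt m))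
        + (1 / (2 * (m : ℝ) - 1) - β) * Real.log (absGaussianMGF (-(μ * (1 - δ)))))) := by
  classical
  have hXm := fun i => (hX i).aemeasurable
  obtain ⟨I, hI1, hI2, hcard⟩ := exists_separated_finset hm K
  set L := K.biUnion (fun i => Finset.univ.image (idx i)) with hL
  have hδ' : 0 < 1 - δ := by linarith
  have hfar : ∀ i i' : Fin n, (m : ℤ) ≤ |((i : ℕ) : ℤ) - ((i' : ℕ) : ℤ)| →
      ∀ j j', idx i j ≠ idx i' j' := by
    intro i i' hii j j' h
    have h1 := hidx _ _ _ _ h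
    have h2 : |((i : ℕ) : ℤ) - ((i' : ℕ) : ℤ)| < m := by
      rw [abs_lt]
      omega
    omega
  have hIK : I ⊆ Kᶜ := by
    intro i hi
    rw [Finset.mem_compl]
    intro hiK
    have := hI2 i hi i hiK
    simp at this
    omega
  let Z : Ω → ℝ := fun ω => μ * Real.sqrt m * ∑ l ∈ L, |X l ω|
    + -(μ * (1 - δ)) * ∑ i ∈ I, |∑ j, v j * X (idx i j) ω|
  have hsub : {ω | (1 - δ) * ∑ i ∈ Kᶜ, |∑ j, v j * X (idx i j) ω|
        ≤ ∑ i ∈ K, |∑ j, v j * X (idx i j) ω| + τ * n} ⊆ {ω | 0 ≤ Z ω + μ * τ * n} := by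
    intro ω hω
    simp only [Set.mem_ofPred_eq] at hω ⊢
    have h1 := sum_abs_rows_le hidx K (fun l => X l ω) v
    have h2 : ∑ i ∈ I, |∑ j, v j * X (idx i j) ω| ≤ ∑ i ∈ Kᶜ, |∑ j, v j * X (idx i j) ω| :=
      Finset.sum_le_sum_of_subset_of_nonneg hIK fun _ _ _ => abs_nonneg _
    have h3 : (∑ j, |v j|) * ∑ l ∈ L, |X l ω| ≤ Real.sqrt m * ∑ l ∈ L, |X l ω| :=
      mul_le_mul_of_nonneg_right (sum_abs_le_sqrt_of_sum_sq_eq_one hv)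
        (Finset.sum_nonneg fun _ _ => abs_nonneg _)
    have h4 := mul_le_mul_of_nonneg_left h2 hδ'.le
    have h5 : (1 - δ) * ∑ i ∈ I, |∑ j, v j * X (idx i j) ω|
        ≤ Real.sqrt m * ∑ l ∈ L, |X l ω| + τ * n := by
      linarith
    have h6 := mul_le_mul_of_nonneg_left h5 hμ.le
    simp only [Z]
    nlinarith
  have hZm : AEMeasurable Z P := by fun_prop
  have hmom := lintegral_exp_abs_sum_add hX hI L I idx
    (fun i j j' h => Fin.ext (by have := hidx _ _ _ _ h; omega))
    (fun i hi i' hi' hne => hfar i i' (hI1 i hi i' hi' hne))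
    (fun i hi j hmem => by
      obtain ⟨k, hk, hkm⟩ := Finset.mem_biUnion.1 hmem
      obtain ⟨j', _, h⟩ := Finset.mem_image.1 hkm
      exact hfar i k (hI2 i hi k hk) j j' h.symm) hv (μ * Real.sqrt m) (-(μ * (1 - δ)))
  have hint : ∫⁻ ω, ENNReal.ofReal (Real.exp (Z ω + μ * τ * n)) ∂P
      = ENNReal.ofReal (Real.exp (μ * τ * n) * (absGaussianMGF (μ * Real.sqrt m) ^ L.card
        * absGaussianMGF (-(μ * (1 - δ))) ^ I.card)) := by
    rw [ENNReal.ofReal_mul (Real.exp_pos _).le, ← hmom, ← lintegral_const_mul'' _ (by fun_prop)]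
    refine lintegral_congr fun ω => ?_
    rw [← ENNReal.ofReal_mul (Real.exp_pos _).le, ← Real.exp_add, add_comm]
  have hle := (measure_mono hsub).trans
    (measure_nonneg_le_lintegral_exp (P := P) (hZm.add_const (μ * τ * n)))
  rw [hint] at hle
  have hA := absGaussianMGF_pos (μ * Real.sqrt m)
  have hB := absGaussianMGF_pos (-(μ * (1 - δ)))
  have hle' := ENNReal.toReal_mono ENNReal.ofReal_ne_top hle
  rw [ENNReal.toReal_ofReal (by positivity)] at hle'
  refine hle'.trans ?_
  set U := Real.log (absGaussianMGF (μ * Real.sqrt m)) with hU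
  set V := Real.log (absGaussianMGF (-(μ * (1 - δ)))) with hV
  -- The signs of `U` and `V` let the upper bound on `|L|` and the lower bound on `|I|` replace the
  -- actual cardinalities.
  have hU0 : 0 ≤ U := Real.log_nonneg (one_le_absGaussianMGF (by positivity))
  have hV0 : V ≤ 0 := Real.log_nonpos hB.le (absGaussianMGF_neg_le_one (by positivity))
  rw [← Real.exp_log hA, ← Real.exp_log hB, ← hU, ← hV, ← Real.exp_nat_mul, ← Real.exp_nat_mul,
    ← Real.exp_add, ← Real.exp_add]
  refine Real.exp_le_exp.2 ?_
  have hLcard : (L.card : ℝ) ≤ m * (β * n) := by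
    have h1 : L.card ≤ K.card * m := Finset.card_biUnion_le_card_mul _ _ _ fun i _ =>
      Finset.card_image_le.trans (by simp)
    have h2 : (L.card : ℝ) ≤ K.card * m := by exact_mod_cast h1
    have h3 : (0 : ℝ) ≤ m := Nat.cast_nonneg m
    nlinarith
  have hIcard : n * (1 / (2 * (m : ℝ) - 1) - β) ≤ I.card := by
    have hm1 : (1 : ℝ) ≤ m := by exact_mod_cast hm
    have hpos : 0 < 2 * (m : ℝ) - 1 := by linarith
    have h1 : (n : ℝ) ≤ (I.card + K.card) * (2 * m - 1) := by
      have : ((2 * m - 1 : ℕ) : ℝ) = 2 * (m : ℝ) - 1 := by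
        rw [Nat.cast_sub (by omega)]; push_cast; ring
      rw [← this]
      exact_mod_cast hcard
    have h2 : n * (1 / (2 * (m : ℝ) - 1)) ≤ I.card + K.card := by
      rw [mul_one_div, div_le_iff₀ hpos]
      exact h1
    linarith
  have h1 := mul_le_mul_of_nonneg_right hLcard hU0
  have h2 := mul_le_mul_of_nonpos_right hIcard hV0
  linarith

lemma measureReal_exists_row_sums_le (hm : 0 < m)
    (hX : ∀ i, HasLaw (X i) (gaussianReal 0 1) P) (hI : iIndepFun X P)
    (hidx : ∀ i j i' j', idx i j = idx i' j' → (i : ℕ) + (j : ℕ) = (i' : ℕ) + (j' : ℕ))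
    {v : Fin m → ℝ} (hv : ∑ j, v j ^ 2 = 1) {μ δ β : ℝ} (hβ0 : 0 < β) (hβ : β ≤ 1 / 2)
    (hμ : 0 < μ) (hδ : δ < 1) (τ : ℝ) :
    P.real {ω | ∃ K : Finset (Fin n), (K.card : ℝ) ≤ β * n ∧
        (1 - δ) * ∑ i ∈ Kᶜ, |∑ j, v j * X (idx i j) ω|
          ≤ ∑ i ∈ K, |∑ j, v j * X (idx i j) ω| + τ * n}
      ≤ Real.exp (n * (μ * τ + rateExponent m β μ δ)) := by
  classical
  set T := (Finset.univ : Finset (Finset (Fin n))).filter fun K => (K.card : ℝ) ≤ β * n with hT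
  have hsub : {ω | ∃ K : Finset (Fin n), (K.card : ℝ) ≤ β * n ∧
        (1 - δ) * ∑ i ∈ Kᶜ, |∑ j, v j * X (idx i j) ω|
          ≤ ∑ i ∈ K, |∑ j, v j * X (idx i j) ω| + τ * n}
      ⊆ ⋃ K ∈ T, {ω | (1 - δ) * ∑ i ∈ Kᶜ, |∑ j, v j * X (idx i j) ω|
          ≤ ∑ i ∈ K, |∑ j, v j * X (idx i j) ω| + τ * n} := by
    rintro ω ⟨K, hK, h⟩
    exact Set.mem_biUnion (Finset.mem_filter.2 ⟨Finset.mem_univ K, hK⟩) h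
  refine (measureReal_mono hsub (measure_ne_top _ _)).trans ((measureReal_biUnion_finset_le _ _).trans ?_)
  refine (Finset.sum_le_card_nsmul _ _ _ fun K hK => measureReal_row_sums_le hm hX hI hidx hv
    hμ hδ K (Finset.mem_filter.1 hK).2 τ).trans ?_
  rw [nsmul_eq_mul]
  refine (mul_le_mul_of_nonneg_right (card_filter_card_le_exp_binEntropy n hβ0 hβ)
    (Real.exp_pos _).le).trans ?_
  rw [← Real.exp_add, rateExponent_eq]
  refine Real.exp_le_exp.2 (le_of_eq ?_)
  ring

end TailBounds

/-! ### The Toeplitz matrix and the net argument -/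

/-- The index in the window of the variable at row `i` and column `j` of the Toeplitz matrix. -/
def toeplitzIndex (n m : ℕ) (i : Fin n) (j : Fin m) : Set.Icc (-(m : ℤ) + 2) (n : ℤ) :=
  ⟨-(m : ℤ) + 2 + ((i : ℕ) : ℤ) + ((j : ℕ) : ℤ), by
    have := i.2
    have := j.2
    constructor <;> omega⟩

lemma toeplitz_mulVec_apply (n m : ℕ) (h : ℤ → ℝ) (z : Fin m → ℝ) (i : Fin n) :
    (toeplitz n m h).mulVec z i = ∑ j, z j * h (toeplitzIndex n m i j) := by
  simp only [Matrix.mulVec, dotProduct, toeplitz, Matrix.of_apply, toeplitzIndex]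
  exact Finset.sum_congr rfl fun j _ => mul_comm _ _

lemma toeplitzIndex_eq {n m : ℕ} (i : Fin n) (j : Fin m) (i' : Fin n) (j' : Fin m)
    (h : toeplitzIndex n m i j = toeplitzIndex n m i' j') :
    (i : ℕ) + (j : ℕ) = (i' : ℕ) + (j' : ℕ) := by
  have := congrArg Subtype.val h
  simp only [toeplitzIndex] at this
  omega

/-- Recovery holds as soon as the strengthened null space property holds on a net of the sphere
and the entries are bounded in mean. -/
lemma recoversAll_of_net {n m : ℕ} {h : ℤ → ℝ} {s δ τ c ε : ℝ} (hδ : 0 ≤ δ) {t : Set (Fin m → ℝ)}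
    (ht : {v : Fin m → ℝ | ∑ j, v j ^ 2 = 1} ⊆ ⋃ v ∈ t, Metric.ball v ε)
    (hsum : ∑ l : Set.Icc (-(m : ℤ) + 2) (n : ℤ), |h l| ≤ c * n) (hε : 0 ≤ ε)
    (hεc : m * ε * c ≤ τ)
    (hnet : ∀ v ∈ t, ∀ K : Finset (Fin n), (K.card : ℝ) ≤ s →
      ∑ i ∈ K, |∑ j, v j * h (toeplitzIndex n m i j)| + τ * n
        < (1 - δ) * ∑ i ∈ Kᶜ, |∑ j, v j * h (toeplitzIndex n m i j)|) :
    RecoversAll (toeplitz n m h) s := by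
  classical
  refine recoversAll_of_nullSpaceProperty fun K hK z hz => ?_
  simp only [toeplitz_mulVec_apply]
  obtain ⟨v, hv, hzv⟩ := Set.mem_iUnion₂.1 (ht hz)
  refine sum_lt_sum_compl_of_close (b := fun i => ∑ j, v j * h (toeplitzIndex n m i j))
    (d := τ * n) ((hnet v hv K hK).trans_le ?_) ?_
  · have : 0 ≤ ∑ i ∈ Kᶜ, |∑ j, v j * h (toeplitzIndex n m i j)| :=
      Finset.sum_nonneg fun _ _ => abs_nonneg _
    nlinarith
  · have h1 := sum_abs_rows_le (idx := toeplitzIndex n m) toeplitzIndex_eq Finset.univ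
      (fun l => h l) (z - v)
    -- Balls are in the sup metric, hence the factor `m`.
    have h2 : ∑ j, |(z - v) j| ≤ m * ε := by
      calc ∑ j, |(z - v) j| ≤ ∑ _j : Fin m, ε := by
            refine Finset.sum_le_sum fun j _ => ?_
            exact (dist_le_pi_dist z v j).trans (Metric.mem_ball.1 hzv).le
        _ = m * ε := by simp
    have h3 : ∑ l ∈ Finset.univ.biUnion (fun i => Finset.univ.image (toeplitzIndex n m i)), |h l|
        ≤ ∑ l : Set.Icc (-(m : ℤ) + 2) (n : ℤ), |h l| :=
      Finset.sum_le_sum_of_subset_of_nonneg (Finset.subset_univ _) fun _ _ _ => abs_nonneg _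
    have h4 : ∀ i : Fin n, ∑ j, z j * h (toeplitzIndex n m i j)
        - ∑ j, v j * h (toeplitzIndex n m i j)
        = ∑ j, (z - v) j * h (toeplitzIndex n m i j) := by
      intro i
      rw [← Finset.sum_sub_distrib]
      exact Finset.sum_congr rfl fun j _ => by rw [Pi.sub_apply, sub_mul]
    simp only [h4]
    refine h1.trans ?_
    calc _ ≤ m * ε * (c * n) :=
          mul_le_mul h2 (h3.trans hsum) (Finset.sum_nonneg fun _ _ => abs_nonneg _) (by positivity)
      _ = m * ε * c * n := by ring
      _ ≤ τ * n := mul_le_mul_of_nonneg_right hεc (Nat.cast_nonneg n)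

/-- The window has `m + n - 1 ≤ mn` variables, and the constant multiplying `n` is chosen to cancel
`mn` moments and leave `exp(-n)`. -/
lemma exp_neg_mul_absGaussianMGF_pow_le {m n : ℕ} (hm : 0 < m) (hn : 0 < n) :
    Real.exp (-((m * Real.log (absGaussianMGF 1) + 1) * n))
        * absGaussianMGF 1 ^ Fintype.card (Set.Icc (-(m : ℤ) + 2) (n : ℤ)) ≤ Real.exp (-n) := by
  have hcard : Fintype.card (Set.Icc (-(m : ℤ) + 2) (n : ℤ)) ≤ m * n := by
    rw [Fintype.card_ofFinset, Int.card_Icc]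
    obtain ⟨a, rfl⟩ := Nat.exists_eq_succ_of_ne_zero hm.ne'
    obtain ⟨b, rfl⟩ := Nat.exists_eq_succ_of_ne_zero hn.ne'
    simp only [Nat.succ_eq_add_one]
    have : (a + 1) * (b + 1) = a * b + a + b + 1 := by ring
    push_cast
    omega
  have h1 := absGaussianMGF_pos 1
  refine (mul_le_mul_of_nonneg_left (pow_le_pow_right₀ (one_le_absGaussianMGF zero_le_one) hcard)
    (Real.exp_pos _).le).trans ?_
  rw [← Real.exp_log (pow_pos h1 _), Real.log_pow, ← Real.exp_add]
  refine Real.exp_le_exp.2 (le_of_eq ?_)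
  push_cast
  ring

theorem exists_recoversAll_probability_ge {m : ℕ} (hm : 0 < m) {β : ℝ} (hadm : IsAdmissible m β) :
    ∃ c₁ : ℝ, 0 < c₁ ∧ ∃ N : ℕ, ∀ n : ℕ, N ≤ n →
      ∀ (Ω : Type*) [MeasurableSpace Ω] (P : Measure Ω) [IsProbabilityMeasure P]
        (h : ℤ → Ω → ℝ),
        (∀ i ∈ Set.Icc (-(m : ℤ) + 2) (n : ℤ), HasLaw (h i) (gaussianReal 0 1) P) →
        iIndepFun (fun i : Set.Icc (-(m : ℤ) + 2) (n : ℤ) => h i) P →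
        1 - Real.exp (-c₁ * n) ≤
          P.real {ω | RecoversAll (toeplitz n m fun i => h i ω) (β * n)} := by
  have hβ := hadm.lt_half hm
  obtain ⟨hβ0, -, μ, δ, hμ, hδ0, hδ1, hrate⟩ := hadm
  have hm' : (0 : ℝ) < m := by exact_mod_cast hm
  -- Half of the rate is spent on the slack, `μτ = r`, and half remains as decay.
  set r := -rateExponent m β μ δ / 2 with hr
  have hr0 : 0 < r := by rw [hr]; linarith
  set c := m * Real.log (absGaussianMGF 1) + 1 with hc
  have hc0 : 0 < c := by
    have := Real.log_nonneg (one_le_absGaussianMGF zero_le_one)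
    positivity
  set τ := r / μ with hτ
  have hτ0 : 0 < τ := by positivity
  set ε := τ / (m * c) with hε
  have hε0 : 0 < ε := by positivity
  obtain ⟨t, hts, htfin, htcover⟩ := (isCompact_setOf_sum_sq_eq_one m).finite_cover_balls hε0
  set q := min r 1 with hq
  have hq0 : 0 < q := lt_min hr0 one_pos
  set T := htfin.toFinset with hT
  -- From `N` on, half of the exponent `q` absorbs the `|T| + 1` terms of the union bound; the later
  -- `N + 1` also forces `n > 0`.
  obtain ⟨N, hN⟩ := exists_nat_ge (Real.log (T.card + 1) / (q / 2))
  refine ⟨q / 2, by positivity, N + 1, fun n hn Ω _ P _ h hlaw hind => ?_⟩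
  have hn0 : 0 < n := by omega
  have hnN : Real.log (T.card + 1) ≤ q / 2 * n := by
    rw [div_le_iff₀ (by positivity)] at hN
    have : (N : ℝ) ≤ n := by exact_mod_cast (by omega : N ≤ n)
    nlinarith
  let X : Set.Icc (-(m : ℤ) + 2) (n : ℤ) → Ω → ℝ := fun i => h i
  have hX : ∀ i, HasLaw (X i) (gaussianReal 0 1) P := fun i => hlaw i i.2
  let bad : (Fin m → ℝ) → Set Ω := fun v => {ω | ∃ K : Finset (Fin n), (K.card : ℝ) ≤ β * n ∧
        (1 - δ) * ∑ i ∈ Kᶜ, |∑ j, v j * X (toeplitzIndex n m i j) ω|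
          ≤ ∑ i ∈ K, |∑ j, v j * X (toeplitzIndex n m i j) ω| + τ * n}
  let large : Set Ω := {ω | c * n ≤ ∑ l, |X l ω|}
  set good := {ω | RecoversAll (toeplitz n m fun i => h i ω) (β * n)} with hgood
  have hcover : Set.univ ⊆ good ∪ ((⋃ v ∈ T, bad v) ∪ large) := by
    intro ω _
    by_contra hω
    simp only [Set.mem_union, not_or, Set.mem_iUnion₂, not_exists] at hω
    obtain ⟨h1, h2, h3⟩ := hω
    refine h1 (recoversAll_of_net hδ0.le htcover (c := c) (τ := τ) (not_le.1 h3).le hε0.le ?_ ?_)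
    · refine le_of_eq ?_
      rw [hε]
      field_simp
    · intro v hv K hK
      by_contra hlt
      exact h2 v (htfin.mem_toFinset.2 hv) ⟨K, hK, not_lt.1 hlt⟩
  have hbad : ∀ v ∈ T, P.real (bad v) ≤ Real.exp (-q * n) := by
    intro v hv
    refine (measureReal_exists_row_sums_le hm hX hind toeplitzIndex_eq
      (hts (htfin.mem_toFinset.1 hv)) hβ0 hβ.le hμ hδ1 τ).trans (Real.exp_le_exp.2 ?_)
    have h1 : μ * τ + rateExponent m β μ δ = -r := by
      rw [hτ, mul_div_cancel₀ _ hμ.ne', hr]; ring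
    rw [h1, mul_comm]
    exact mul_le_mul_of_nonneg_right (neg_le_neg (min_le_left _ _)) (Nat.cast_nonneg n)
  have hlarge : P.real large ≤ Real.exp (-q * n) := by
    refine (measureReal_sum_abs_ge_le hX hind (c * n)).trans
      ((exp_neg_mul_absGaussianMGF_pow_le hm hn0).trans (Real.exp_le_exp.2 ?_))
    have : q * n ≤ 1 * n := mul_le_mul_of_nonneg_right (min_le_right _ _) (Nat.cast_nonneg n)
    linarith
  have hunion : P.real (⋃ v ∈ T, bad v) ≤ T.card * Real.exp (-q * n) := by
    refine (measureReal_biUnion_finset_le _ _).trans ?_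
    rw [← nsmul_eq_mul]
    exact Finset.sum_le_card_nsmul _ _ _ hbad
  have htotal : 1 ≤ P.real good + (P.real (⋃ v ∈ T, bad v) + P.real large) := by
    calc (1 : ℝ) = P.real Set.univ := by simp
      _ ≤ P.real (good ∪ ((⋃ v ∈ T, bad v) ∪ large)) := measureReal_mono hcover (measure_ne_top _ _)
      _ ≤ P.real good + P.real ((⋃ v ∈ T, bad v) ∪ large) := measureReal_union_le _ _
      _ ≤ _ := by gcongr; exact measureReal_union_le _ _
  have hfinal : (T.card + 1) * Real.exp (-q * n) ≤ Real.exp (-(q / 2) * n) := by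
    rw [← Real.exp_log (show (0 : ℝ) < T.card + 1 by positivity), ← Real.exp_add]
    refine Real.exp_le_exp.2 ?_
    linarith
  linarith

end ToeplitzL1

theorem theorem1 (m : ℕ) (hm : 0 < m) :
    (∃ β : ℝ, ToeplitzL1.IsAdmissible m β) ∧
    ∀ β : ℝ, ToeplitzL1.IsAdmissible m β →
      ∃ c₁ : ℝ, 0 < c₁ ∧ ∃ N : ℕ, ∀ n : ℕ, N ≤ n →
        ∀ (Ω : Type*) [MeasurableSpace Ω] (P : Measure Ω) [IsProbabilityMeasure P]
          (h : ℤ → Ω → ℝ),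
          (∀ i ∈ Set.Icc (-(m : ℤ) + 2) (n : ℤ), HasLaw (h i) (gaussianReal 0 1) P) →
          iIndepFun (fun i : Set.Icc (-(m : ℤ) + 2) (n : ℤ) => h i) P →
          1 - Real.exp (-c₁ * n) ≤
            P.real {ω | ToeplitzL1.RecoversAll
              (ToeplitzL1.toeplitz n m fun i => h i ω) (β * n)} :=
  ⟨ToeplitzL1.exists_isAdmissible hm,
    fun _ hβ => ToeplitzL1.exists_recoversAll_probability_ge hm hβ⟩
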